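/- Let $s(n,m)$ and $S(n,m)$ denote the (signed) Stirling numbers of the first kind and the Stirling numbers of the second kind, so that $\sum_{m=0}^n s(n,m)x^m = x(x-1)\cdots(x-n+1)$ and $\sum_{m=0}^n S(n,m)\,x(x-1)\cdots(x-m+1) = x^n$. Let $n\ge 3$ and $2\le k\le n$ be integers. Put $N:=\binom n2$ and \[ \mu_1 := \binom k2\frac{n(n-1)(2n-1)}{6N^2},\qquad \mu_2 := \binom k2\frac{n(n-1)(4n-5)}{6N^2}, \] \[ d_1 := \frac{n(n-1)(2n-1)}{6N^2} + 2(k-2)\frac{n(n-1)(2n-1)}{6N^2} + \frac{3(k-2)n(n-1)}{(2n-1)N} + \frac{2(k-2)(n+1)}{N}, \] \[ d_2 := \frac{n(n-1)(4n-5)}{6N^2} + 2\left(4(k-2)\frac{n(n-1)(2n-1)}{6N^2} + \frac{3(k-2)n(n-1)}{(4n-5)N} + \frac{2(k-2)(2n-1)(n+1)}{(4n-5)N}\right), \] \[ D_1 := \min(d_1,\ \mu_1 d_1,\ 1),\qquad D_2 := \min(d_2,\ \mu_2 d_2,\ 1). \] Then \[ \frac{N^k}{k!}e^{-\mu_2}\left(1-e^{\mu_2}D_2\right)\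 \le\ S(n,n-k)\ \le\ \frac{N^k}{k!}e^{-\mu_2}\left(1+e^{\mu_2}D_2\right), \] \[ \frac{N^k}{k!}e^{-\mu_1}\left(1-e^{\mu_1}D_1\right)\ \le\ |s(n,n-k)|\ \le\ \frac{N^k}{k!}e^{-\mu_1}\left(1+e^{\mu_1}D_1\right). \] -/

import Mathlib

noncomputable section

namespace StirlingIndep

/-- The (signed) Stirling number of the first kind `s(n, m)`: the coefficient of `x ^ m` in the
falling factorial `x (x - 1) ⋯ (x - n + 1)`. -/
def signedStirlingFirst (n m : ℕ) : ℤ := (descPochhammer ℤ n).coeff m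

/-- The number `N` of squares strictly below the diagonal of an `n × n` board, as a real number. -/
def N (n : ℕ) : ℝ := (n.choose 2 : ℝ)

/-- The Poisson rate for Stirling numbers of the first kind. -/
def mu1 (n k : ℕ) : ℝ :=
  (k.choose 2 : ℝ) * ((n : ℝ) * (n - 1) * (2 * n - 1) / (6 * N n ^ 2))

/-- The Poisson rate for Stirling numbers of the second kind. -/
def mu2 (n k : ℕ) : ℝ :=
  (k.choose 2 : ℝ) * ((n : ℝ) * (n - 1) * (4 * n - 5) / (6 * N n ^ 2))

/-- The quantity `d₁`; all subtractions are in `ℝ`. -/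
def d1 (n k : ℕ) : ℝ :=
  (n : ℝ) * (n - 1) * (2 * n - 1) / (6 * N n ^ 2)
    + 2 * ((k : ℝ) - 2) * ((n : ℝ) * (n - 1) * (2 * n - 1) / (6 * N n ^ 2))
    + 3 * ((k : ℝ) - 2) * n * (n - 1) / ((2 * n - 1) * N n)
    + 2 * ((k : ℝ) - 2) * (n + 1) / N n

/-- The quantity `d₂`; all subtractions are in `ℝ`. -/
def d2 (n k : ℕ) : ℝ :=
  (n : ℝ) * (n - 1) * (4 * n - 5) / (6 * N n ^ 2)
    + 2 * (4 * ((k : ℝ) - 2) * ((n : ℝ) * (n - 1) * (2 * n - 1) / (6 * N n ^ 2))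
      + 3 * ((k : ℝ) - 2) * n * (n - 1) / ((4 * n - 5) * N n)
      + 2 * ((k : ℝ) - 2) * (2 * n - 1) * (n + 1) / ((4 * n - 5) * N n))

/-- The error term for the first kind: the factor in the middle entry is the Poisson rate
`mu1`. -/
def D1 (n k : ℕ) : ℝ := min (d1 n k) (min (mu1 n k * d1 n k) 1)

/-- The error term for the second kind: the factor in the middle entry is the Poisson rate
`mu2`.  Since `mu2 ≤ 2 * mu1` and `mu2 ≤ 2 * mu2`, this is at most the term obtained with
`2 * mu1` or `2 * mu2` as that factor, so the bounds with this term are the sharpest. -/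
def D2 (n k : ℕ) : ℝ := min (d2 n k) (min (mu2 n k * d2 n k) 1)

end StirlingIndep

end

/-!
Both Stirling numbers count placements of `k` squares on the staircase board with `N` squares
below the diagonal of an `n × n` board: `|s(n, n - k)|` counts placements with no two squares in
one row (`card_sameRow_eq_stirlingFirst`), and `S(n, n - k)` counts placements of non-attacking
rooks (`card_attack_eq_stirlingSecond`).  Hence `k! |s(n, n - k)| / N ^ k` and
`k! S(n, n - k) / N ^ k` are probabilities that `k` independent uniform squares show no collision
(`card_no_collision_eq`), where collision means "same row", respectively "same row or column".

Let `W` be the number of colliding pairs among the `k` squares and let `p` be the probability that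
two squares collide, so that `W` has mean `l = (k choose 2) p`.  The function
`t ↦ exp (-l t) E[t ^ W]` equals `P(W = 0)` at `t = 0` and `exp (-l)` at `t = 1`, so
`P(W = 0) - exp (-l)` is the integral over `[0, 1]` of
`exp (-l t) (l E[t ^ W] - E[W t ^ (W - 1)])`.  This is the Stein–Chen equation for the set `{0}`,
and bounding `∫ exp (-l t)` by `min 1 (1 / l)` gives the factor of the error term
(`abs_card_zero_sub_le`).  The bracket is a sum over pairs `{i, j}` of
`p E[t ^ W] - E[X t ^ (W - 1)]`, with `X` the indicator that `i` and `j` collide.  Replacing `W`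
by the number of collisions that avoid `i` and `j`, which is independent of `X`, makes this
difference vanish; the cost of the replacement is controlled by the at most `2 (k - 2)` further
pairs meeting `{i, j}` (`abs_local_term_le`).  If a square collides with at most `Δ` squares, the
resulting error is `p + 2 (k - 2) p + 2 (k - 2) Δ / N`, and with `Δ = n - 1`, respectively
`Δ = 2 n - 3`, this is at most `d1`, respectively `d2` (`error_sameRow_le`, `error_attack_le`).
-/

namespace StirlingIndep

open Finset

/-! ### Poisson approximation through the generating function -/

/-- The function `t ↦ e^{-lt} ∑ t ^ W` runs from the number of zeros of `W` at `t = 0` to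
`|Ω| e^{-l}` at `t = 1`, and `h` bounds its derivative by `C e^{-lt}`.  The two parts integrate
this bound as `C` and as `C / l`. -/
theorem abs_card_zero_sub_le {Ω : Type*} [Fintype Ω] (W : Ω → ℕ) (l C : ℝ) (hl : 0 ≤ l)
    (h : ∀ t ∈ Set.Icc (0 : ℝ) 1,
      |l * ∑ ω, t ^ W ω - ∑ ω, (W ω : ℝ) * t ^ (W ω - 1)| ≤ C) :
    |(#{ω | W ω = 0} : ℝ) - Fintype.card Ω * Real.exp (-l)| ≤ C ∧
    l * |(#{ω | W ω = 0} : ℝ) - Fintype.card Ω * Real.exp (-l)| ≤ C := by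
  have hC : 0 ≤ C := (abs_nonneg _).trans (h 0 (by simp))
  set G : ℝ → ℝ := fun t => Real.exp (-l * t) * ∑ ω, t ^ W ω with hG
  have hexp (t : ℝ) : HasDerivAt (fun t => Real.exp (-l * t)) (Real.exp (-l * t) * -l) t := by
    simpa using ((hasDerivAt_id t).const_mul (-l)).exp
  have hder (t : ℝ) : HasDerivAt G (-(Real.exp (-l * t) *
      (l * ∑ ω, t ^ W ω - ∑ ω, (W ω : ℝ) * t ^ (W ω - 1)))) t := by
    have h2 : HasDerivAt (fun t : ℝ => ∑ ω, t ^ W ω) (∑ ω, (W ω : ℝ) * t ^ (W ω - 1)) t :=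
      HasDerivAt.fun_sum fun ω _ => hasDerivAt_pow (W ω) t
    exact ((hexp t).mul h2).congr_deriv (by ring)
  have hbd : ∀ t ∈ Set.Ico (0 : ℝ) 1, |-(Real.exp (-l * t) *
      (l * ∑ ω, t ^ W ω - ∑ ω, (W ω : ℝ) * t ^ (W ω - 1)))| ≤ Real.exp (-l * t) * C := by
    intro t ht
    rw [abs_neg, abs_mul, Real.abs_exp]
    exact mul_le_mul_of_nonneg_left (h t ⟨ht.1, ht.2.le⟩) (Real.exp_pos _).le
  have h0 : G 0 = #{ω | W ω = 0} := by
    simp [hG, zero_pow_eq]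
  have h1 : G 1 = Fintype.card Ω * Real.exp (-l) := by
    simp [hG, mul_comm]
  rw [← h0, ← h1, abs_sub_comm]
  have one_mem : (1 : ℝ) ∈ Set.Icc (0 : ℝ) 1 := by simp
  have hder' (c t : ℝ) := ((hder t).sub_const (G 0)).const_mul c
  have hcont (c : ℝ) : ContinuousOn (fun t => c * (G t - G 0)) (Set.Icc 0 1) :=
    fun t _ => (hder' c t).continuousAt.continuousWithinAt
  constructor
  -- The derivative is at most `C`, and at most that of `C (1 - exp (-l t)) / l`; in the second
  -- case the factor `l` is moved to the left so that `l = 0` is allowed.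
  · have := image_norm_le_of_norm_deriv_right_le_deriv_boundary (B := fun t => C * t)
      (B' := fun _ => C) (hcont 1) (fun t _ => (hder' 1 t).hasDerivWithinAt) (by simp)
      (fun t => by simpa using (hasDerivAt_id t).const_mul C) (fun t ht => by
        rw [one_mul, Real.norm_eq_abs]
        refine (hbd t ht).trans (mul_le_of_le_one_left hC ?_)
        exact Real.exp_le_one_iff.2 (by nlinarith [ht.1])) one_mem
    simpa using this
  · have := image_norm_le_of_norm_deriv_right_le_deriv_boundary
      (B := fun t => C * (1 - Real.exp (-l * t)))
      (B' := fun t => C * -(Real.exp (-l * t) * -l))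
      (hcont l) (fun t _ => (hder' l t).hasDerivWithinAt) (by simp)
      (fun t => ((hexp t).const_sub 1).const_mul C) (fun t ht => by
        rw [norm_mul, Real.norm_eq_abs, Real.norm_eq_abs, abs_of_nonneg hl]
        calc _ ≤ l * _ := mul_le_mul_of_nonneg_left (hbd t ht) hl
          _ = _ := by ring) one_mem
    rw [norm_mul, Real.norm_eq_abs, Real.norm_eq_abs, abs_of_nonneg hl] at this
    refine this.trans (mul_le_of_le_one_right hC ?_)
    linarith [Real.exp_pos (-l * 1)]

/-! ### Collisions in a uniformly random tuple -/

section Hit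

variable {ι S : Type*} (R : S → S → Prop) [DecidableRel R]

/-- The indicator of the event that coordinates `i` and `j` of `ω` are related. -/
def hit (ω : ι → S) (i j : ι) : ℕ := if R (ω i) (ω j) then 1 else 0

theorem hit_comm (hR : ∀ a b, R a b → R b a) (ω : ι → S) (i j : ι) :
    hit R ω i j = hit R ω j i := by
  simp only [hit]
  exact if_congr ⟨hR _ _, hR _ _⟩ rfl rfl

/-- The number of related ordered pairs of elements of `S`. -/
def pairCount [Fintype S] : ℕ := ∑ a, #{b | R a b}

end Hit

section Collisions

variable {ι S : Type*} [Fintype ι] [DecidableEq ι] [Fintype S]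

/-- Resampling one coordinate preserves the uniform distribution on tuples. -/
theorem card_mul_sum_eq_sum_update (i : ι) (g : (ι → S) → ℝ) :
    Fintype.card S * ∑ ω, g ω = ∑ ω, ∑ a, g (Function.update ω i a) := by
  have hinv : Function.Involutive
      (fun x : (ι → S) × S => (Function.update x.1 i x.2, x.1 i)) := by
    rintro ⟨ω, a⟩
    simp
  rw [← Fintype.sum_prod_type' (f := fun ω a => g (Function.update ω i a)),
    ← Equiv.sum_comp hinv.toPerm, Fintype.sum_prod_type]
  simp [Finset.mul_sum]

variable (R : S → S → Prop) [DecidableRel R]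

/-- The event that coordinates `i ≠ j` are related is independent of any function `F` of the
other coordinates. -/
theorem card_sq_mul_sum_hit_mul {i j : ι} (hij : i ≠ j) (F : (ι → S) → ℝ)
    (hi : ∀ ω a, F (Function.update ω i a) = F ω) (hj : ∀ ω a, F (Function.update ω j a) = F ω) :
    (Fintype.card S : ℝ) ^ 2 * ∑ ω, (hit R ω i j : ℝ) * F ω = pairCount R * ∑ ω, F ω := by
  rw [pow_two, mul_assoc, card_mul_sum_eq_sum_update i, card_mul_sum_eq_sum_update j,
    Finset.mul_sum]
  refine Finset.sum_congr rfl fun ω _ => ?_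
  rw [Finset.sum_comm]
  simp [hi, hj, hit, pairCount, hij.symm, Finset.sum_ite, Finset.sum_mul]

/-- If every element is related to at most `Δ` others, then two events sharing a coordinate are
correlated at most by the factor `Δ / |S|`. -/
theorem card_mul_sum_hit_mul_hit_le {i j l : ι} (hli : l ≠ i) (hlj : l ≠ j) (Δ : ℕ)
    (hΔ : ∀ a, #{b | R a b} ≤ Δ) :
    (Fintype.card S : ℝ) * ∑ ω, (hit R ω i j : ℝ) * hit R ω i l
      ≤ Δ * ∑ ω, (hit R ω i j : ℝ) := by
  rw [card_mul_sum_eq_sum_update l, Finset.mul_sum]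
  refine Finset.sum_le_sum fun ω _ => ?_
  have h1 : ∑ a, (hit R (Function.update ω l a) i l : ℝ) = #{b | R (ω i) b} := by
    simp [hit, hli.symm]
  have h2 (a : S) : hit R (Function.update ω l a) i j = hit R ω i j := by
    simp [hit, hli.symm, hlj.symm]
  simp_rw [h2, ← Finset.mul_sum, h1]
  rw [mul_comm]
  exact mul_le_mul_of_nonneg_right (mod_cast hΔ _) (Nat.cast_nonneg _)

end Collisions

/-! ### Poisson approximation under local dependence -/

section PoissonBound

variable {ι S : Type*} [Fintype ι] [LinearOrder ι] [Fintype S]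

variable (ι) in
/-- The two-element subsets of `ι`, encoded as increasing pairs. -/
def pairs : Finset (ι × ι) := {q | q.1 < q.2}

theorem card_pairs_fin (k : ℕ) : #(pairs (Fin k)) = k.choose 2 := by
  have : #(pairs (Fin k)) = ∑ j : Fin k, (j : ℕ) := by
    rw [pairs, Finset.card_filter, Fintype.sum_prod_type_right]
    refine Finset.sum_congr rfl fun j _ => ?_
    rw [← Finset.card_filter]
    exact (congrArg _ (by ext; simp)).trans (Fin.card_Iio j)
  rw [this, Fin.sum_univ_eq_sum_range (fun i => i), Finset.sum_range_id, Nat.choose_two_right]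

/-- The pairs other than `(i, j)` that meet `{i, j}`. -/
def touching (i j : ι) : Finset (ι × ι) :=
  {q ∈ pairs ι | q ≠ (i, j) ∧ (q.1 = i ∨ q.1 = j ∨ q.2 = i ∨ q.2 = j)}

/-- The pairs disjoint from `{i, j}`. -/
def avoiding (i j : ι) : Finset (ι × ι) :=
  {q ∈ pairs ι | q.1 ≠ i ∧ q.1 ≠ j ∧ q.2 ≠ i ∧ q.2 ≠ j}

theorem sum_pairs_eq (x : ι × ι → ℕ) {i j : ι} (hij : i < j) :
    ∑ q ∈ pairs ι, x q = ∑ q ∈ avoiding i j, x q + x (i, j) + ∑ q ∈ touching i j, x q := by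
  have hmem : (i, j) ∈ (pairs ι).filter
      (fun q => ¬ (q.1 ≠ i ∧ q.1 ≠ j ∧ q.2 ≠ i ∧ q.2 ≠ j)) := by simp [pairs, hij]
  rw [← Finset.sum_filter_add_sum_filter_not (pairs ι)
    (fun q => q.1 ≠ i ∧ q.1 ≠ j ∧ q.2 ≠ i ∧ q.2 ≠ j), ← Finset.add_sum_erase _ _ hmem,
    ← add_assoc]
  congr 2
  ext q
  simp only [touching, mem_erase, mem_filter]
  tauto

theorem sum_touching_le (x : ι → ι → ℕ) (hx : ∀ a b, x a b = x b a) {i j : ι}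
    (hij : i < j) :
    ∑ q ∈ touching i j, x q.1 q.2 ≤ ∑ l ∈ ({i, j} : Finset ι)ᶜ, (x i l + x j l) := by
  set L : Finset ι := ({i, j} : Finset ι)ᶜ with hL
  -- `s i l` is the pair `{i, l}` in increasing order.
  let s (i l : ι) : ι × ι := (min i l, max i l)
  have hs (i : ι) : Function.Injective (s i) := by
    intro a b hab
    simp only [s, Prod.mk.injEq] at hab
    grind
  have hsum (i : ι) : ∑ q ∈ L.image (s i), x q.1 q.2 = ∑ l ∈ L, x i l := by
    rw [Finset.sum_image (hs i).injOn]
    refine Finset.sum_congr rfl fun l _ => ?_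
    rcases le_total i l with h | h <;> simp [s, h, hx l i]
  rw [Finset.sum_add_distrib, ← hsum i, ← hsum j, ← Finset.sum_union_inter]
  refine le_trans (Finset.sum_le_sum_of_subset ?_) (Nat.le_add_right _ _)
  rintro ⟨a, b⟩ hq
  simp only [touching, pairs, mem_filter, mem_univ, true_and, ne_eq, Prod.mk.injEq] at hq
  simp only [mem_union, mem_image, hL, mem_compl, mem_insert, mem_singleton, s, Prod.mk.injEq]
  obtain ⟨hab, hne, h⟩ := hq
  by_cases h1 : a = i
  · exact .inl ⟨b, by grind⟩
  by_cases h2 : a = j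
  · exact .inr ⟨b, by grind⟩
  by_cases h3 : b = i
  · exact .inl ⟨a, by grind⟩
  · exact .inr ⟨a, by grind⟩

theorem abs_pow_add_sub_pow_le {t : ℝ} (h0 : 0 ≤ t) (h1 : t ≤ 1) (v a : ℕ) :
    |t ^ (v + a) - t ^ v| ≤ a := by
  rcases Nat.eq_zero_or_pos a with rfl | ha
  · simp
  have hle : t ^ (v + a) ≤ t ^ v := pow_le_pow_of_le_one h0 h1 (Nat.le_add_right _ _)
  have hv : t ^ v ≤ 1 := pow_le_one₀ h0 h1
  have hp : 0 ≤ t ^ (v + a) := pow_nonneg h0 _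
  have ha' : (1 : ℝ) ≤ a := mod_cast ha
  rw [abs_le]
  constructor <;> linarith

variable (R : S → S → Prop) [DecidableRel R]

/-- The number of pairs of coordinates of `ω` that are related. -/
def collisions (ω : ι → S) : ℕ := ∑ q ∈ pairs ι, hit R ω q.1 q.2

/-- The collision probability: the probability that two independent uniform elements of `S` are
related. -/
noncomputable def pairProb : ℝ := pairCount R / (Fintype.card S : ℝ) ^ 2

theorem pairProb_nonneg : 0 ≤ pairProb R := by unfold pairProb; positivity

variable [Nonempty S]

theorem sum_hit_mul {i j : ι} (hij : i ≠ j) (F : (ι → S) → ℝ)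
    (hi : ∀ ω a, F (Function.update ω i a) = F ω) (hj : ∀ ω a, F (Function.update ω j a) = F ω) :
    ∑ ω, (hit R ω i j : ℝ) * F ω = pairProb R * ∑ ω, F ω := by
  have hT : (0 : ℝ) < Fintype.card S := mod_cast Fintype.card_pos
  have := card_sq_mul_sum_hit_mul R hij F hi hj
  rw [pairProb]
  field_simp
  linarith

theorem sum_hit {i j : ι} (hij : i ≠ j) :
    ∑ ω : ι → S, (hit R ω i j : ℝ) = pairProb R * (Fintype.card (ι → S) : ℝ) := by
  simpa using sum_hit_mul R hij (fun _ => 1) (by simp) (by simp)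

theorem sum_hit_mul_hit_le {i j l : ι} (hij : i ≠ j) (hli : l ≠ i) (hlj : l ≠ j) (Δ : ℕ)
    (hΔ : ∀ a, #{b | R a b} ≤ Δ) :
    ∑ ω : ι → S, (hit R ω i j : ℝ) * hit R ω i l
      ≤ Δ / Fintype.card S * (pairProb R * (Fintype.card (ι → S) : ℝ)) := by
  have hT : (0 : ℝ) < Fintype.card S := mod_cast Fintype.card_pos
  have := card_mul_sum_hit_mul_hit_le (ι := ι) R hli hlj Δ hΔ
  rw [sum_hit R hij] at this
  rw [div_mul_eq_mul_div, le_div_iff₀ hT]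
  linarith

/-- The contribution of the pair `(i, j)` to the derivative estimate.  Both terms are compared
with the generating function of the collisions that avoid `i` and `j`, which are independent of
whether `i` and `j` collide. -/
theorem abs_local_term_le (hR : ∀ a b, R a b → R b a) (Δ : ℕ) (hΔ : ∀ a, #{b | R a b} ≤ Δ)
    {i j : ι} (hij : i < j) {t : ℝ} (h0 : 0 ≤ t) (h1 : t ≤ 1) :
    |pairProb R * ∑ ω : ι → S, t ^ collisions R ω
        - ∑ ω : ι → S, (hit R ω i j : ℝ) * t ^ (collisions R ω - 1)|
      ≤ Fintype.card (ι → S) * (pairProb R *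
        (pairProb R + 2 * ((Fintype.card ι : ℝ) - 2) * pairProb R
          + 2 * ((Fintype.card ι : ℝ) - 2) * (Δ / Fintype.card S))) := by
  set p := pairProb R
  set M : ℝ := Nat.cast (Fintype.card (ι → S))
  have hp : 0 ≤ p := pairProb_nonneg R
  have hne : i ≠ j := hij.ne
  set L : Finset ι := ({i, j} : Finset ι)ᶜ with hL
  have hcardL : (#L : ℝ) = (Fintype.card ι : ℝ) - 2 := by
    rw [hL, Finset.card_compl, Nat.cast_sub (Finset.card_le_univ _), Finset.card_pair hne]
    norm_num
  -- `V` and `Z` count the collisions of the pairs disjoint from `{i, j}` and of the other pairs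
  -- meeting it; `Y` bounds `Z` by a sum over third coordinates.
  let V (ω : ι → S) : ℕ := ∑ q ∈ avoiding i j, hit R ω q.1 q.2
  let Z (ω : ι → S) : ℕ := ∑ q ∈ touching i j, hit R ω q.1 q.2
  let Y (ω : ι → S) : ℕ := ∑ l ∈ L, (hit R ω i l + hit R ω j l)
  have hW (ω : ι → S) : collisions R ω = V ω + hit R ω i j + Z ω :=
    sum_pairs_eq (fun q => hit R ω q.1 q.2) hij
  have hZY (ω : ι → S) : Z ω ≤ Y ω := sum_touching_le (hit R ω) (hit_comm R hR ω) hij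
  have hVi (ω : ι → S) (a : S) : V (Function.update ω i a) = V ω := by
    refine Finset.sum_congr rfl fun q hq => ?_
    simp only [avoiding, mem_filter] at hq
    simp [hit, hq.2]
  have hVj (ω : ι → S) (a : S) : V (Function.update ω j a) = V ω := by
    refine Finset.sum_congr rfl fun q hq => ?_
    simp only [avoiding, mem_filter] at hq
    simp [hit, hq.2]
  have hind : ∑ ω, (hit R ω i j : ℝ) * t ^ V ω = p * ∑ ω, t ^ V ω :=
    sum_hit_mul R hne _ (fun ω a => by rw [hVi]) (fun ω a => by rw [hVj])
  have hfirst (ω : ι → S) : |t ^ collisions R ω - t ^ V ω| ≤ hit R ω i j + Y ω := by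
    rw [hW, add_assoc]
    refine (abs_pow_add_sub_pow_le h0 h1 _ _).trans ?_
    exact_mod_cast Nat.add_le_add_left (hZY ω) _
  have hsecond (ω : ι → S) :
      |(hit R ω i j : ℝ) * (t ^ V ω - t ^ (collisions R ω - 1))| ≤ hit R ω i j * Y ω := by
    by_cases h : R (ω i) (ω j)
    · have h' : hit R ω i j = 1 := if_pos h
      rw [hW, h', show V ω + 1 + Z ω - 1 = V ω + Z ω by omega, Nat.cast_one, one_mul, one_mul,
        abs_sub_comm]
      exact (abs_pow_add_sub_pow_le h0 h1 _ _).trans (mod_cast hZY ω)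
    · simp [hit, h]
  have hsplit : p * ∑ ω : ι → S, t ^ collisions R ω
        - ∑ ω : ι → S, (hit R ω i j : ℝ) * t ^ (collisions R ω - 1)
      = p * ∑ ω, (t ^ collisions R ω - t ^ V ω)
        + ∑ ω, (hit R ω i j : ℝ) * (t ^ V ω - t ^ (collisions R ω - 1)) := by
    simp only [mul_sub, Finset.sum_sub_distrib, hind]
    ring
  have hY : ∑ ω, (Y ω : ℝ) = 2 * ((Fintype.card ι : ℝ) - 2) * (p * M) := by
    simp only [Y, Nat.cast_sum, Nat.cast_add]
    rw [Finset.sum_comm, ← hcardL, mul_comm 2, mul_assoc, ← nsmul_eq_mul]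
    refine Finset.sum_eq_card_nsmul fun l hl => ?_
    simp only [hL, mem_compl, mem_insert, mem_singleton, not_or] at hl
    rw [Finset.sum_add_distrib, sum_hit R (Ne.symm hl.1), sum_hit R (Ne.symm hl.2)]
    ring
  have hXY : ∑ ω, (hit R ω i j : ℝ) * Y ω
      ≤ 2 * ((Fintype.card ι : ℝ) - 2) * (Δ / Fintype.card S * (p * M)) := by
    simp only [Y, Nat.cast_sum, Nat.cast_add, Finset.mul_sum]
    rw [Finset.sum_comm, ← hcardL, mul_comm 2, mul_assoc, ← nsmul_eq_mul]
    refine Finset.sum_le_card_nsmul _ _ _ fun l hl => ?_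
    simp only [hL, mem_compl, mem_insert, mem_singleton, not_or] at hl
    simp only [mul_add, Finset.sum_add_distrib]
    have e1 := sum_hit_mul_hit_le (ι := ι) R hne hl.1 hl.2 Δ hΔ
    have e2 := sum_hit_mul_hit_le (ι := ι) R hne.symm hl.2 hl.1 Δ hΔ
    simp only [hit_comm R hR _ j i] at e2
    linarith
  calc _ ≤ p * ∑ ω : ι → S, ((hit R ω i j : ℝ) + Y ω) + ∑ ω, (hit R ω i j : ℝ) * Y ω := by
        rw [hsplit]
        refine (abs_add_le _ _).trans (add_le_add ?_ ?_)
        · rw [abs_mul, abs_of_nonneg hp]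
          refine mul_le_mul_of_nonneg_left ?_ hp
          exact (Finset.abs_sum_le_sum_abs _ _).trans (Finset.sum_le_sum fun ω _ => hfirst ω)
        · exact (Finset.abs_sum_le_sum_abs _ _).trans (Finset.sum_le_sum fun ω _ => hsecond ω)
    _ ≤ _ := by
        rw [Finset.sum_add_distrib, sum_hit R hne, hY]
        linarith

/-- Poisson approximation for the probability of no collision. -/
theorem abs_card_no_collision_sub_le (hR : ∀ a b, R a b → R b a) (Δ : ℕ)
    (hΔ : ∀ a, #{b | R a b} ≤ Δ) {k : ℕ} (hk : 2 ≤ k) {l d : ℝ} (hl : l = k.choose 2 * pairProb R)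
    (hd : pairProb R + 2 * ((k : ℝ) - 2) * pairProb R
      + 2 * ((k : ℝ) - 2) * (Δ / Fintype.card S) ≤ d) :
    |(#{ω : Fin k → S | ∀ i j, i < j → ¬ R (ω i) (ω j)} : ℝ) / (Fintype.card S : ℝ) ^ k
      - Real.exp (-l)| ≤ min d (min (l * d) 1) := by
  have hp := pairProb_nonneg R
  have hl0 : 0 ≤ l := by rw [hl]; positivity
  have hT : (0 : ℝ) < (Fintype.card S : ℝ) ^ k := pow_pos (mod_cast Fintype.card_pos) k
  have hM : (Fintype.card (Fin k → S) : ℝ) = (Fintype.card S : ℝ) ^ k := by simp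
  have hzero : (#{ω : Fin k → S | ∀ i j, i < j → ¬ R (ω i) (ω j)}) =
      #{ω : Fin k → S | collisions R ω = 0} := by
    congr 1
    ext ω
    simp [collisions, pairs, hit]
  have key := abs_card_zero_sub_le (collisions R : (Fin k → S) → ℕ) l
    ((Fintype.card S : ℝ) ^ k * (l * d)) hl0 (by
      rintro t ⟨h0, h1⟩
      have hsum : l * ∑ ω : Fin k → S, t ^ collisions R ω
            - ∑ ω : Fin k → S, (collisions R ω : ℝ) * t ^ (collisions R ω - 1)
          = ∑ q ∈ pairs (Fin k), (pairProb R * ∑ ω : Fin k → S, t ^ collisions R ω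
            - ∑ ω : Fin k → S, (hit R ω q.1 q.2 : ℝ) * t ^ (collisions R ω - 1)) := by
        rw [Finset.sum_sub_distrib, Finset.sum_const, card_pairs_fin, Finset.sum_comm, hl,
          nsmul_eq_mul, mul_assoc]
        congr 1
        refine Finset.sum_congr rfl fun ω _ => ?_
        rw [← Finset.sum_mul, ← Nat.cast_sum]
        rfl
      rw [hsum]
      refine (Finset.abs_sum_le_sum_abs _ _).trans ?_
      refine (Finset.sum_le_card_nsmul _ _ ((Fintype.card S : ℝ) ^ k * (pairProb R * d))
        fun q hq => ?_).trans_eq ?_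
      · refine (abs_local_term_le R hR Δ hΔ (by simpa [pairs] using hq) h0 h1).trans ?_
        rw [hM, Fintype.card_fin]
        gcongr
      · rw [card_pairs_fin, nsmul_eq_mul, hl]
        ring)
  rw [← hzero, hM] at key
  set c : ℝ := (#{ω : Fin k → S | ∀ i j, i < j → ¬ R (ω i) (ω j)} : ℝ) with hc
  set T : ℝ := (Fintype.card S : ℝ) ^ k
  have habs : |c - T * Real.exp (-l)| = T * |c / T - Real.exp (-l)| := by
    rw [← abs_of_pos hT, ← abs_mul, abs_of_pos hT]
    congr 1
    field_simp
  rw [habs] at key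
  have hc0 : 0 ≤ c / T := by positivity
  have hc1 : c / T ≤ 1 := by
    rw [div_le_one hT, ← hM, hc]
    exact_mod_cast Finset.card_le_univ _
  have he0 := Real.exp_pos (-l)
  have he1 : Real.exp (-l) ≤ 1 := Real.exp_le_one_iff.2 (by linarith)
  have htriv : |c / T - Real.exp (-l)| ≤ 1 := abs_le.2 ⟨by linarith, by linarith⟩
  have hfirst : |c / T - Real.exp (-l)| ≤ l * d := le_of_mul_le_mul_left key.1 hT
  refine le_min ?_ (le_min hfirst htriv)
  -- For `l = 0` the second estimate of `key` is empty, but then the first one gives `0`.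
  rcases hl0.eq_or_lt with h | h
  · have hk' : 0 ≤ (k : ℝ) - 2 := sub_nonneg.2 (mod_cast hk)
    have hd0 : 0 ≤ d := le_trans (by positivity) hd
    exact (hfirst.trans_eq (by rw [← h, zero_mul])).trans hd0
  · refine le_of_mul_le_mul_left ?_ (mul_pos h hT)
    linarith [key.2]

end PoissonBound

/-! ### Stirling numbers as numbers of placements on the staircase board -/

/-- The squares strictly below the diagonal of an `n × n` board, as pairs (row, column). -/
def board (n : ℕ) : Finset (ℕ × ℕ) := {q ∈ range n ×ˢ range n | q.2 < q.1}

theorem mem_board {n : ℕ} {q : ℕ × ℕ} : q ∈ board n ↔ q.1 < n ∧ q.2 < q.1 := by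
  simp only [board, mem_filter, mem_product, mem_range]
  omega

/-- The `k`-element subsets of `B` no two elements of which are related by `R`. -/
def independentSets {α : Type*} [DecidableEq α] (R : α → α → Prop) [DecidableRel R]
    (B : Finset α) (k : ℕ) : Finset (Finset α) :=
  {s ∈ B.powersetCard k | ∀ x ∈ s, ∀ y ∈ s, x ≠ y → ¬ R x y}

/-- A tuple without collisions is an independent set together with one of its `k!` orderings. -/
theorem card_no_collision_eq {α : Type*} [DecidableEq α] (R : α → α → Prop) [DecidableRel R]
    (hrefl : ∀ a, R a a) (hR : ∀ a b, R a b → R b a) (B : Finset α) (k : ℕ) :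
    #{ω : Fin k → B | ∀ i j, i < j → ¬ R (ω i) (ω j)} =
      k.factorial * #(independentSets R B k) := by
  have hne {ω : Fin k → B} (h : ∀ i j, i < j → ¬ R (ω i) (ω j)) {i j : Fin k} (hij : i ≠ j) :
      ¬ R (ω i) (ω j) := by
    rcases lt_or_gt_of_ne hij with h' | h'
    · exact h _ _ h'
    · exact fun hr => h _ _ h' (hR _ _ hr)
  have hinj {ω : Fin k → B} (h : ∀ i j, i < j → ¬ R (ω i) (ω j)) : Function.Injective ω := by
    intro i j hij
    by_contra hn
    exact hne h hn (hij ▸ hrefl _)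
  rw [Finset.card_eq_sum_card_fiberwise (t := independentSets R B k)
    (f := fun ω : Fin k → B => univ.image fun i => (ω i : α))]
  · rw [mul_comm, ← smul_eq_mul]
    refine Finset.sum_eq_card_nsmul fun s hs => ?_
    simp only [independentSets, mem_filter, mem_powersetCard] at hs
    obtain ⟨⟨hsB, hsk⟩, hsR⟩ := hs
    have hcard : Fintype.card (Fin k ↪ s) = k.factorial := by
      rw [Fintype.card_embedding_eq, Fintype.card_coe, Fintype.card_fin, hsk,
        Nat.descFactorial_self]
    rw [← hcard, ← Finset.card_univ]
    -- The orderings of `s` are the embeddings of `Fin k` into `s`.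
    symm
    refine Finset.card_bij (fun e _ i => ⟨e i, hsB (e i).2⟩) ?_ ?_ ?_
    · intro e _
      simp only [mem_filter, mem_univ, true_and]
      refine ⟨fun i j hij => hsR _ (e i).2 _ (e j).2 fun h =>
        hij.ne (e.injective (Subtype.ext h)), ?_⟩
      refine Finset.eq_of_subset_of_card_le ?_ ?_
      · intro x hx
        obtain ⟨i, -, rfl⟩ := mem_image.1 hx
        exact (e i).2
      · rw [Finset.card_image_of_injective _
          (f := fun i => (e i : α)) (Subtype.val_injective.comp e.injective), hsk]
        simp
    · intro e _ e' _ h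
      ext i
      exact congrArg (fun x : B => (x : α)) (congrFun h i)
    · intro ω hω
      simp only [mem_filter, mem_univ, true_and] at hω
      obtain ⟨hω, rfl⟩ := hω
      refine ⟨⟨fun i => ⟨ω i, mem_image_of_mem _ (mem_univ i)⟩, fun i j hij => ?_⟩,
        mem_univ _, rfl⟩
      exact hinj hω (Subtype.ext (Subtype.mk.inj hij))
  · intro ω hω
    simp only [coe_filter, mem_univ, true_and, Set.mem_ofPred_eq] at hω
    simp only [independentSets, coe_filter, mem_powersetCard, Set.mem_ofPred_eq]
    refine ⟨⟨?_, ?_⟩, ?_⟩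
    · intro x hx
      obtain ⟨i, -, rfl⟩ := mem_image.1 hx
      exact (ω i).2
    · rw [Finset.card_image_of_injective _
        (f := fun i => (ω i : α)) (Subtype.val_injective.comp (hinj hω))]
      simp
    · intro x hx y hy hxy
      obtain ⟨i, -, rfl⟩ := mem_image.1 hx
      obtain ⟨j, -, rfl⟩ := mem_image.1 hy
      exact hne hω fun h => hxy (h ▸ rfl)

section Placements

variable (R : ℕ × ℕ → ℕ × ℕ → Prop) [DecidableRel R]

theorem card_independentSets_zero (n : ℕ) : #(independentSets R (board n) 0) = 1 := by
  simp [independentSets, Finset.filter_singleton]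

/-- Row `0` of the board is empty, so at most `n - 1` squares lie in different rows. -/
theorem independentSets_eq_empty (hrow : ∀ x y, x.1 = y.1 → R x y) {n k : ℕ} (hk : 0 < k)
    (hnk : n ≤ k) : independentSets R (board n) k = ∅ := by
  rw [Finset.eq_empty_iff_forall_notMem]
  intro s hs
  simp only [independentSets, mem_filter, mem_powersetCard] at hs
  obtain ⟨⟨hsB, hsk⟩, hsR⟩ := hs
  have hinj : Set.InjOn Prod.fst (s : Set (ℕ × ℕ)) := by
    intro x hx y hy hxy
    by_contra h
    exact hsR x hx y hy h (hrow _ _ hxy)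
  have hsub : s.image Prod.fst ⊆ Ico 1 n := by
    intro i hi
    obtain ⟨x, hx, rfl⟩ := mem_image.1 hi
    have := mem_board.1 (hsB hx)
    rw [mem_Ico]
    omega
  have := Finset.card_le_card hsub
  rw [Finset.card_image_of_injOn hinj, Nat.card_Ico, hsk] at this
  omega

/-- Removing the last row: a placement either leaves row `n` empty or has exactly one square
there. -/
theorem card_independentSets_succ (hrow : ∀ x y, x.1 = y.1 → R x y)
    (hR : ∀ a b, R a b → R b a) (n k c : ℕ)
    (hc : ∀ s ∈ independentSets R (board n) k, #{j ∈ range n | ∀ x ∈ s, ¬ R (n, j) x} = c) :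
    #(independentSets R (board (n + 1)) (k + 1)) =
      #(independentSets R (board n) (k + 1)) + c * #(independentSets R (board n) k) := by
  rw [← Finset.card_filter_add_card_filter_not (fun s => ∀ x ∈ s, x.1 ≠ n)]
  congr 1
  · congr 1
    ext s
    simp only [independentSets, mem_filter, mem_powersetCard, Finset.subset_iff, mem_board]
    constructor
    · rintro ⟨⟨⟨h1, h2⟩, h3⟩, h4⟩
      exact ⟨⟨fun x hx => ⟨by have := h1 hx; have := h4 x hx; omega, (h1 hx).2⟩, h2⟩, h3⟩
    · rintro ⟨⟨h1, h2⟩, h3⟩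
      exact ⟨⟨⟨fun x hx => ⟨by have := h1 hx; omega, (h1 hx).2⟩, h2⟩, h3⟩,
        fun x hx => (h1 hx).1.ne⟩
  -- Placements with a square in row `n` arise uniquely by adding a free square of that row to a
  -- placement on the smaller board.
  · have hsig : c * #(independentSets R (board n) k) =
        #((independentSets R (board n) k).sigma
          fun s => {j ∈ range n | ∀ x ∈ s, ¬ R (n, j) x}) := by
      rw [Finset.card_sigma, Finset.sum_congr rfl hc, Finset.sum_const, smul_eq_mul, mul_comm]
    have hnot {s : Finset (ℕ × ℕ)} (hs : s ∈ independentSets R (board n) k) (j : ℕ) :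
        (n, j) ∉ s := by
      intro h
      simp only [independentSets, mem_filter, mem_powersetCard] at hs
      exact lt_irrefl _ (mem_board.1 (hs.1.1 h)).1
    rw [hsig]
    symm
    refine Finset.card_bij (fun p _ => insert (n, p.2) p.1) ?_ ?_ ?_
    · rintro ⟨s, j⟩ hsj
      rw [mem_sigma] at hsj
      have hnj := hnot hsj.1 j
      obtain ⟨hs, hj⟩ := hsj
      simp only [independentSets, mem_filter, mem_powersetCard, mem_range] at hs hj
      obtain ⟨⟨hsB, hsk⟩, hsR⟩ := hs
      obtain ⟨hj, hjR⟩ := hj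
      simp only [independentSets, mem_filter, mem_powersetCard]
      refine ⟨⟨⟨?_, ?_⟩, ?_⟩, ?_⟩
      · intro x hx
        rcases mem_insert.1 hx with rfl | hx
        · exact mem_board.2 ⟨Nat.lt_succ_self n, hj⟩
        · have := mem_board.1 (hsB hx)
          exact mem_board.2 ⟨by omega, this.2⟩
      · rw [Finset.card_insert_of_notMem hnj, hsk]
      · intro x hx y hy hxy
        rcases mem_insert.1 hx with rfl | hx <;> rcases mem_insert.1 hy with rfl | hy
        · exact absurd rfl hxy
        · exact hjR y hy
        · exact fun h => hjR x hx (hR _ _ h)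
        · exact hsR x hx y hy hxy
      · exact fun h => h _ (mem_insert_self _ _) rfl
    · rintro ⟨s, j⟩ hsj ⟨s', j'⟩ hsj' h
      rw [mem_sigma] at hsj hsj'
      have hj : j = j' := by
        have : (n, j) ∈ insert (n, j') s' := h ▸ mem_insert_self _ _
        rcases mem_insert.1 this with h | h
        · exact (Prod.mk.inj h).2
        · exact absurd h (hnot hsj'.1 j)
      subst hj
      have : s = s' := by
        rw [← Finset.erase_insert (a := (n, j)) (s := s) (hnot hsj.1 j),
          ← Finset.erase_insert (a := (n, j)) (s := s') (hnot hsj'.1 j)]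
        exact congrArg (Finset.erase · (n, j)) h
      rw [this]
    · intro t ht
      simp only [independentSets, mem_filter, mem_powersetCard, not_forall, not_not] at ht
      obtain ⟨⟨⟨htB, htk⟩, htR⟩, ⟨i, j⟩, hx, hin⟩ := ht
      obtain rfl : i = n := hin
      refine ⟨⟨t.erase (i, j), j⟩, ?_, Finset.insert_erase hx⟩
      simp only [independentSets, mem_sigma, mem_filter, mem_powersetCard, mem_range]
      refine ⟨⟨⟨?_, ?_⟩, ?_⟩, (mem_board.1 (htB hx)).2, ?_⟩
      · intro y hy
        rw [mem_erase] at hy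
        have h1 := mem_board.1 (htB hy.2)
        have h2 : y.1 ≠ i := fun h => htR y hy.2 _ hx hy.1 (hrow _ _ h)
        exact mem_board.2 ⟨by omega, h1.2⟩
      · rw [Finset.card_erase_of_mem hx, htk, Nat.add_sub_cancel]
      · intro y hy z hz
        exact htR y (mem_of_mem_erase hy) z (mem_of_mem_erase hz)
      · intro y hy
        rw [mem_erase] at hy
        exact htR _ hx y hy.2 (Ne.symm hy.1)

end Placements

/-- Two squares lie in the same row. -/
def SameRow (x y : ℕ × ℕ) : Prop := x.1 = y.1

/-- Two squares lie in the same row or in the same column, as for attacking rooks. -/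
def Attack (x y : ℕ × ℕ) : Prop := x.1 = y.1 ∨ x.2 = y.2

instance : DecidableRel SameRow := fun x y => inferInstanceAs (Decidable (x.1 = y.1))

instance : DecidableRel Attack := fun x y => inferInstanceAs (Decidable (x.1 = y.1 ∨ x.2 = y.2))

theorem card_sameRow_succ (n k : ℕ) :
    #(independentSets SameRow (board (n + 1)) (k + 1)) =
      #(independentSets SameRow (board n) (k + 1)) +
        n * #(independentSets SameRow (board n) k) := by
  refine card_independentSets_succ SameRow (fun _ _ h => h) (fun _ _ h => Eq.symm h) n k n ?_
  intro s hs
  simp only [independentSets, mem_filter, mem_powersetCard] at hs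
  rw [Finset.filter_true_of_mem, Finset.card_range]
  intro j _ x hx
  exact (mem_board.1 (hs.1.1 hx)).1.ne'

theorem card_attack_succ (n k : ℕ) :
    #(independentSets Attack (board (n + 1)) (k + 1)) =
      #(independentSets Attack (board n) (k + 1)) +
        (n - k) * #(independentSets Attack (board n) k) := by
  refine card_independentSets_succ Attack (fun _ _ h => .inl h)
    (fun _ _ h => h.imp Eq.symm Eq.symm) n k (n - k) ?_
  intro s hs
  simp only [independentSets, mem_filter, mem_powersetCard] at hs
  obtain ⟨⟨hsB, hsk⟩, hsR⟩ := hs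
  have hfree : {j ∈ range n | ∀ x ∈ s, ¬ Attack (n, j) x} = range n \ s.image Prod.snd := by
    ext j
    simp only [mem_filter, mem_sdiff, mem_image, not_exists, not_and, Attack, not_or]
    refine and_congr_right fun _ => forall₂_congr fun x hx => ?_
    exact ⟨fun h => Ne.symm h.2, fun h => ⟨(mem_board.1 (hsB hx)).1.ne', Ne.symm h⟩⟩
  have hinj : Set.InjOn Prod.snd (s : Set (ℕ × ℕ)) := by
    intro x hx y hy hxy
    by_contra h
    exact hsR x hx y hy h (.inr hxy)
  rw [hfree, Finset.card_sdiff_of_subset, Finset.card_image_of_injOn hinj, card_range, hsk]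
  intro j hj
  obtain ⟨x, hx, rfl⟩ := mem_image.1 hj
  have := mem_board.1 (hsB hx)
  rw [mem_range]
  omega

theorem card_sameRow_eq_stirlingFirst (m k : ℕ) :
    #(independentSets SameRow (board (m + k)) k) = Nat.stirlingFirst (m + k) m := by
  induction k generalizing m with
  | zero => rw [card_independentSets_zero, Nat.add_zero, Nat.stirlingFirst_self]
  | succ k ihk =>
    induction m with
    | zero =>
      rw [independentSets_eq_empty SameRow (fun _ _ h => h) k.succ_pos (by omega), zero_add,
        Nat.stirlingFirst_succ_zero, card_empty]
    | succ m ihm =>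
      rw [← add_assoc, card_sameRow_succ, ihk, Nat.stirlingFirst_succ_succ,
        show m + 1 + k = m + (k + 1) by ring, ihm, add_comm]

theorem card_attack_eq_stirlingSecond (m k : ℕ) :
    #(independentSets Attack (board (m + k)) k) = Nat.stirlingSecond (m + k) m := by
  induction k generalizing m with
  | zero => rw [card_independentSets_zero, Nat.add_zero, Nat.stirlingSecond_self]
  | succ k ihk =>
    induction m with
    | zero =>
      rw [independentSets_eq_empty Attack (fun _ _ h => .inl h) k.succ_pos (by omega), zero_add,
        Nat.stirlingSecond_succ_zero, card_empty]
    | succ m ihm =>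
      rw [← add_assoc, card_attack_succ, ihk, Nat.stirlingSecond_succ_succ, Nat.add_sub_cancel,
        show m + 1 + k = m + (k + 1) by ring, ihm, add_comm]

theorem signedStirlingFirst_eq (n m : ℕ) :
    signedStirlingFirst n m = (-1) ^ (n + m) * Nat.stirlingFirst n m := by
  unfold signedStirlingFirst
  induction n generalizing m with
  | zero => cases m <;> simp [Polynomial.coeff_one]
  | succ n ih =>
    rw [descPochhammer_succ_right, ← Polynomial.C_eq_natCast]
    cases m with
    | zero =>
      rw [Polynomial.mul_coeff_zero, ih, Nat.stirlingFirst_succ_zero]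
      cases n <;> simp
    | succ m =>
      rw [Polynomial.coeff_mul_X_sub_C, ih, ih, Nat.stirlingFirst_succ_succ]
      push_cast
      ring

theorem abs_signedStirlingFirst (n m : ℕ) :
    |(signedStirlingFirst n m : ℝ)| = Nat.stirlingFirst n m := by
  rw [signedStirlingFirst_eq]
  push_cast
  rw [abs_mul, abs_pow, abs_neg, abs_one, one_pow, one_mul, Nat.abs_cast]

/-! ### Collision probabilities on the staircase board -/

theorem sum_board {M : Type*} [AddCommMonoid M] (n : ℕ) (f : ℕ × ℕ → M) :
    ∑ q ∈ board n, f q = ∑ i ∈ range n, ∑ j ∈ range i, f (i, j) :=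
  Finset.sum_finset_product _ _ _ fun q => by simp [mem_board]

theorem card_board (n : ℕ) : (#(board n) : ℝ) = N n := by
  rw [Finset.card_eq_sum_ones, sum_board, N]
  simp [Finset.sum_range_id, Nat.choose_two_right]

theorem card_row {n : ℕ} {a : ℕ × ℕ} (ha : a ∈ board n) :
    #{b ∈ board n | a.1 = b.1} = a.1 := by
  have : {b ∈ board n | a.1 = b.1} = (range a.1).image (Prod.mk a.1) := by
    rw [mem_board] at ha
    ext ⟨x, y⟩
    simp only [mem_filter, mem_board, mem_image, mem_range, Prod.mk.injEq]
    constructor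
    · rintro ⟨h, rfl⟩
      exact ⟨y, h.2, rfl, rfl⟩
    · rintro ⟨z, hz, rfl, rfl⟩
      exact ⟨⟨ha.1, hz⟩, rfl⟩
  rw [this, Finset.card_image_of_injective _ (Prod.mk_right_injective _), card_range]

theorem card_column (n : ℕ) (a : ℕ × ℕ) :
    #{b ∈ board n | a.2 = b.2} = n - (a.2 + 1) := by
  have : {b ∈ board n | a.2 = b.2} = (Ico (a.2 + 1) n).image (fun i => (i, a.2)) := by
    ext ⟨x, y⟩
    simp only [mem_filter, mem_board, mem_image, mem_Ico, Prod.mk.injEq]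
    constructor
    · rintro ⟨h, rfl⟩
      exact ⟨x, ⟨h.2, h.1⟩, rfl, rfl⟩
    · rintro ⟨z, hz, rfl, rfl⟩
      exact ⟨⟨hz.2, hz.1⟩, rfl⟩
  rw [this, Finset.card_image_of_injective _ (Prod.mk_left_injective _), Nat.card_Ico]

/-- The row and the column of a square have only that square in common. -/
theorem card_attacked {n : ℕ} {a : ℕ × ℕ} (ha : a ∈ board n) :
    #{b ∈ board n | Attack a b} + a.2 + 2 = a.1 + n := by
  have hinter : {b ∈ board n | a.1 = b.1} ∩ {b ∈ board n | a.2 = b.2} = {a} := by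
    ext b
    simp only [mem_inter, mem_filter, mem_singleton, Prod.ext_iff]
    constructor
    · rintro ⟨⟨-, h1⟩, -, h2⟩
      exact ⟨h1.symm, h2.symm⟩
    · rintro ⟨h1, h2⟩
      have : b = a := Prod.ext h1 h2
      exact ⟨⟨this ▸ ha, h1.symm⟩, this ▸ ha, h2.symm⟩
  have hunion : {b ∈ board n | Attack a b} =
      {b ∈ board n | a.1 = b.1} ∪ {b ∈ board n | a.2 = b.2} := by
    rw [← Finset.filter_or]
    rfl
  have h := Finset.card_union_add_card_inter {b ∈ board n | a.1 = b.1} {b ∈ board n | a.2 = b.2}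
  rw [hinter, card_singleton, ← hunion, card_row ha, card_column n a] at h
  have := mem_board.1 ha
  omega

theorem card_filter_subtype {α : Type*} (B : Finset α) (P : α → Prop) [DecidablePred P] :
    #{b : B | P b} = #{b ∈ B | P b} := by
  rw [Finset.card_filter, Finset.card_filter, ← Finset.sum_coe_sort B]

theorem pairCount_sameRow (n : ℕ) :
    (pairCount (fun a b : board n => SameRow a b) : ℝ) =
      (n : ℝ) * (n - 1) * (2 * n - 1) / 6 := by
  have h : pairCount (fun a b : board n => SameRow a b) = ∑ a ∈ board n, a.1 := by
    rw [← Finset.sum_coe_sort, pairCount]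
    refine Finset.sum_congr rfl fun a _ => ?_
    rw [card_filter_subtype (board n) (SameRow a)]
    exact card_row a.2
  rw [h, sum_board]
  simp only [sum_const, card_range, smul_eq_mul, Nat.cast_sum, Nat.cast_mul]
  clear h
  induction n with
  | zero => simp
  | succ n ih =>
    rw [Finset.sum_range_succ, ih]
    push_cast
    ring

theorem pairCount_attack (n : ℕ) :
    (pairCount (fun a b : board n => Attack a b) : ℝ) =
      (n : ℝ) * (n - 1) * (4 * n - 5) / 6 := by
  have h : (pairCount (fun a b : board n => Attack a b) : ℝ) =
      ∑ a ∈ board n, ((a.1 : ℝ) + (n - 2) - a.2) := by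
    rw [← Finset.sum_coe_sort, pairCount, Nat.cast_sum]
    refine Finset.sum_congr rfl fun a _ => ?_
    rw [card_filter_subtype (board n) (Attack a)]
    have : ((#{b ∈ board n | Attack a b} + a.1.2 + 2 : ℕ) : ℝ) = ((a.1.1 + n : ℕ) : ℝ) :=
      congrArg _ (card_attacked a.2)
    push_cast at this
    linarith
  have hrow (c : ℝ) (i : ℕ) :
      ∑ j ∈ range i, ((i : ℝ) + c - j) = i * (i + c) - i * (i - 1) / 2 := by
    have hid : ∀ m : ℕ, ∑ j ∈ range m, (j : ℝ) = m * (m - 1) / 2 := fun m => by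
      induction m with
      | zero => simp
      | succ m ih =>
        rw [Finset.sum_range_succ, ih]
        push_cast
        ring
    rw [Finset.sum_sub_distrib, hid, Finset.sum_const, card_range, nsmul_eq_mul]
  have hsum (c : ℝ) (m : ℕ) : ∑ i ∈ range m, ((i : ℝ) * (i + c) - i * (i - 1) / 2) =
      m * (m - 1) * (2 * m - 1) / 12 + (c + 1 / 2) * (m * (m - 1) / 2) := by
    induction m with
    | zero => simp
    | succ m ih =>
      rw [Finset.sum_range_succ, ih]
      push_cast
      ring
  rw [h, sum_board]
  simp only [hrow, hsum]
  ring

/-! ### The error terms and the final estimate -/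

theorem N_eq (n : ℕ) : N n = (n : ℝ) * (n - 1) / 2 := Nat.cast_choose_two ℝ n

theorem pairProb_sameRow (n : ℕ) : pairProb (fun a b : board n => SameRow a b) =
    (n : ℝ) * (n - 1) * (2 * n - 1) / (6 * N n ^ 2) := by
  rw [pairProb, pairCount_sameRow, Fintype.card_coe, card_board, div_div]

theorem pairProb_attack (n : ℕ) : pairProb (fun a b : board n => Attack a b) =
    (n : ℝ) * (n - 1) * (4 * n - 5) / (6 * N n ^ 2) := by
  rw [pairProb, pairCount_attack, Fintype.card_coe, card_board, div_div]

/-- A row has at most `n - 1` squares, and `(n - 1) / N = 2 / n` is small enough for `d1`. -/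
theorem error_sameRow_le {n k : ℕ} (hn : 3 ≤ n) (hk : 2 ≤ k) :
    pairProb (fun a b : board n => SameRow a b)
      + 2 * ((k : ℝ) - 2) * pairProb (fun a b : board n => SameRow a b)
      + 2 * ((k : ℝ) - 2) * ((n - 1 : ℕ) / (Fintype.card (board n) : ℝ)) ≤ d1 n k := by
  have hn' : (3 : ℝ) ≤ n := mod_cast hn
  have hk' : (0 : ℝ) ≤ (k : ℝ) - 2 := sub_nonneg.2 (mod_cast hk)
  have hN : 0 < N n := by rw [N_eq]; nlinarith
  have h : ((n : ℝ) - 1) / N n ≤ (n + 1) / N n := by gcongr; linarith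
  have h2 : 0 ≤ 3 * ((k : ℝ) - 2) * n * (n - 1) / ((2 * n - 1) * N n) :=
    div_nonneg (mul_nonneg (by positivity) (by linarith)) (mul_nonneg (by linarith) hN.le)
  have h3 := mul_le_mul_of_nonneg_left h (mul_nonneg zero_le_two hk')
  rw [pairProb_sameRow, Fintype.card_coe, card_board, d1, Nat.cast_sub (by omega), Nat.cast_one]
  rw [mul_div_assoc (2 * ((k : ℝ) - 2)) ((n : ℝ) + 1)]
  linarith

/-- A square attacks at most `2 n - 3` squares, itself included. -/
theorem error_attack_le {n k : ℕ} (hn : 3 ≤ n) (hk : 2 ≤ k) :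
    pairProb (fun a b : board n => Attack a b)
      + 2 * ((k : ℝ) - 2) * pairProb (fun a b : board n => Attack a b)
      + 2 * ((k : ℝ) - 2) * ((2 * n - 3 : ℕ) / (Fintype.card (board n) : ℝ)) ≤ d2 n k := by
  have hn' : (3 : ℝ) ≤ n := mod_cast hn
  have hk' : (0 : ℝ) ≤ (k : ℝ) - 2 := sub_nonneg.2 (mod_cast hk)
  have hN : 0 < N n := by rw [N_eq]; nlinarith
  have h5 : (0 : ℝ) < 4 * n - 5 := by linarith
  have hid : (n : ℝ) * (n - 1) = 2 * N n := by rw [N_eq]; ring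
  rw [pairProb_attack, Fintype.card_coe, card_board, d2, Nat.cast_sub (by omega)]
  push_cast
  have e1 (x : ℝ) : (n : ℝ) * (n - 1) * x / (6 * N n ^ 2) = x / (3 * N n) := by
    rw [hid]; field_simp; ring
  have e2 : 3 * ((k : ℝ) - 2) * n * (n - 1) / ((4 * n - 5) * N n) =
      (k - 2) * (3 * (n * (n - 1)) / (4 * n - 5) / N n) := by field_simp
  have e3 : 2 * ((k : ℝ) - 2) * (2 * n - 1) * (n + 1) / ((4 * n - 5) * N n) =
      (k - 2) * (2 * (2 * n - 1) * (n + 1) / (4 * n - 5) / N n) := by field_simp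
  rw [e1, e1, e2, e3]
  have main : ((4 : ℝ) * n - 5) / 3 + (2 * n - 3) ≤
      4 * ((2 * n - 1) / 3) + 3 * (n * (n - 1)) / (4 * n - 5)
        + 2 * (2 * n - 1) * (n + 1) / (4 * n - 5) := by
    rw [add_assoc (4 * ((2 * (n : ℝ) - 1) / 3)), ← add_div, ← sub_le_iff_le_add', le_div_iff₀ h5]
    nlinarith
  have main' := mul_le_mul_of_nonneg_left (div_le_div_of_nonneg_right main hN.le) hk'
  have e4 (x : ℝ) : x / (3 * N n) = x / 3 / N n := by rw [div_div]
  rw [e4, e4]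
  simp only [add_div, mul_add, mul_div_assoc] at main' ⊢
  linarith

/-- The estimate for the probability of no collision, rescaled to the number of placements. -/
theorem card_independentSets_bounds (R : ℕ × ℕ → ℕ × ℕ → Prop) [DecidableRel R]
    (hrefl : ∀ a, R a a) (hR : ∀ a b, R a b → R b a) {n k Δ : ℕ} (hn : 3 ≤ n) (hk : 2 ≤ k)
    (hΔ : ∀ a ∈ board n, #{b ∈ board n | R a b} ≤ Δ) {l d : ℝ}
    (hl : l = k.choose 2 * pairProb (fun a b : board n => R a b))
    (hd : pairProb (fun a b : board n => R a b)
      + 2 * ((k : ℝ) - 2) * pairProb (fun a b : board n => R a b)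
      + 2 * ((k : ℝ) - 2) * (Δ / Fintype.card (board n)) ≤ d) :
    N n ^ k / (k.factorial : ℝ) * Real.exp (-l) * (1 - Real.exp l * min d (min (l * d) 1))
        ≤ #(independentSets R (board n) k) ∧
      (#(independentSets R (board n) k) : ℝ)
        ≤ N n ^ k / (k.factorial : ℝ) * Real.exp (-l)
          * (1 + Real.exp l * min d (min (l * d) 1)) := by
  have : Nonempty (board n) := ⟨⟨(1, 0), mem_board.2 ⟨by omega, one_pos⟩⟩⟩
  have hn' : (3 : ℝ) ≤ n := mod_cast hn
  have hN : 0 < N n := by rw [N_eq]; nlinarith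
  have key := abs_card_no_collision_sub_le (fun a b : board n => R a b) (fun a b => hR a b) Δ
    (fun a => (card_filter_subtype (board n) (R a)).trans_le (hΔ a a.2)) hk hl hd
  rw [card_no_collision_eq R hrefl hR, Fintype.card_coe, card_board, Nat.cast_mul] at key
  set D := min d (min (l * d) 1)
  set c : ℝ := (#(independentSets R (board n) k) : ℝ)
  have hf : (0 : ℝ) < k.factorial := mod_cast k.factorial_pos
  have hq : 0 < N n ^ k / (k.factorial : ℝ) := by positivity
  have hc : c = N n ^ k / (k.factorial : ℝ) * (k.factorial * c / N n ^ k) := by field_simp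
  have hexp : Real.exp (-l) * Real.exp l = 1 := by rw [← Real.exp_add]; simp
  have hminus : N n ^ k / (k.factorial : ℝ) * Real.exp (-l) * (1 - Real.exp l * D) =
      N n ^ k / (k.factorial : ℝ) * (Real.exp (-l) - D) := by
    rw [mul_assoc, mul_sub, ← mul_assoc (Real.exp (-l)), hexp, one_mul, mul_one]
  have hplus : N n ^ k / (k.factorial : ℝ) * Real.exp (-l) * (1 + Real.exp l * D) =
      N n ^ k / (k.factorial : ℝ) * (Real.exp (-l) + D) := by
    rw [mul_assoc, mul_add, ← mul_assoc (Real.exp (-l)), hexp, one_mul, mul_one]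
  obtain ⟨h1, h2⟩ := abs_le.1 key
  rw [hminus, hplus, hc]
  exact ⟨mul_le_mul_of_nonneg_left (by linarith) hq.le,
    mul_le_mul_of_nonneg_left (by linarith) hq.le⟩

end StirlingIndep

theorem mainTheorem3 (n k : ℕ) (hn : 3 ≤ n) (hk : 2 ≤ k) (hkn : k ≤ n) :
    (StirlingIndep.N n ^ k / (k.factorial : ℝ) * Real.exp (-StirlingIndep.mu2 n k)
          * (1 - Real.exp (StirlingIndep.mu2 n k) * StirlingIndep.D2 n k)
        ≤ (Nat.stirlingSecond n (n - k) : ℝ) ∧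
      (Nat.stirlingSecond n (n - k) : ℝ)
        ≤ StirlingIndep.N n ^ k / (k.factorial : ℝ) * Real.exp (-StirlingIndep.mu2 n k)
          * (1 + Real.exp (StirlingIndep.mu2 n k) * StirlingIndep.D2 n k)) ∧
    (StirlingIndep.N n ^ k / (k.factorial : ℝ) * Real.exp (-StirlingIndep.mu1 n k)
          * (1 - Real.exp (StirlingIndep.mu1 n k) * StirlingIndep.D1 n k)
        ≤ |(StirlingIndep.signedStirlingFirst n (n - k) : ℝ)| ∧
      |(StirlingIndep.signedStirlingFirst n (n - k) : ℝ)|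
        ≤ StirlingIndep.N n ^ k / (k.factorial : ℝ) * Real.exp (-StirlingIndep.mu1 n k)
          * (1 + Real.exp (StirlingIndep.mu1 n k) * StirlingIndep.D1 n k)) := by
  open StirlingIndep in
  obtain ⟨m, rfl⟩ : ∃ m, n = m + k := ⟨n - k, (Nat.sub_add_cancel hkn).symm⟩
  rw [Nat.add_sub_cancel, abs_signedStirlingFirst, ← card_attack_eq_stirlingSecond,
    ← card_sameRow_eq_stirlingFirst]
  refine ⟨card_independentSets_bounds Attack (fun _ => .inl rfl)
    (fun _ _ h => h.imp Eq.symm Eq.symm) hn hk (fun a ha => ?_) (by rw [pairProb_attack, mu2])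
    (error_attack_le hn hk), card_independentSets_bounds SameRow (fun _ => rfl)
    (fun _ _ h => Eq.symm h) hn hk (fun a ha => ?_) (by rw [pairProb_sameRow, mu1])
    (error_sameRow_le hn hk)⟩
  · have := card_attacked ha
    have := mem_board.1 ha
    omega
  · have := mem_board.1 ha
    exact (card_row ha).trans_le (by omega)
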